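/- **Setting.** Let $M$ be a connected smooth 4-manifold without boundary (Hausdorff, second countable, not necessarily compact). A *full symbol* is $\mathbf S_{\rm full}(x,p)=\mathbf E^\alpha(x)p_\alpha+\mathbf F(x)$, where in local coordinates $\mathbf E^\alpha$ ($\alpha=1,\dots,4$) and $\mathbf F$ are smooth Hermitian $2\times2$ complex matrix-functions, $(\mathbf E^\alpha)$ being a vector density and $\mathbf F$ a density. It is assumed non-degenerate: its principal symbol $\mathbf S_{\rm prin}(x,p)=\mathbf E^\alpha(x)p_\alpha$ is a nonzero matrix for every $x$ and every $p\neq0$. (Such symbols correspond to the non-degenerate Hermitian first order sesquilinear forms $\int_M[-\frac i2u^*\mathbf E^\alpha v_{x^\alpha}+\frac i2u^*_{x^\alpha}\mathbf E^\alpha v+u^*\mathbf Fv]\,dx$ on $C_0^\infty(M,\mathbb C^2)$.) Put $\mathbf S_{\rm sub}=\mathbf F$. Repeated indices are summed. Two full symbols are *$SL$-equivalent* if there is a smooth $R:M\to SL(2,\mathbb C)$ with $$\tilde{\mathbf S}_{\rm full}=R^*\mathbf S_{\rm full}R+\tfrac i2\left[R^*_{x^\alpha}(\mathbf S_{\rm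 full})_{p_\alpha}R-R^*(\mathbf S_{\rm full})_{p_\alpha}R_{x^\alpha}\right].$$ A full symbol encodes the following objects. * *Metric.* Let $\mathbf g^{\alpha\beta}$ be the real symmetric matrix-function with $\det\mathbf S_{\rm prin}(x,p)=-\mathbf g^{\alpha\beta}(x)p_\alpha p_\beta$, and $\mathbf g_{\alpha\beta}$ its inverse. Put $\rho=(-\det\mathbf g^{\mu\nu})^{1/6}$. The Lorentzian metric is $g^{\alpha\beta}=\rho^{-2}\mathbf g^{\alpha\beta}$. * *Electromagnetic covector potential.* This is the unique real covector field $A$ with $\mathbf S_{\rm csub}(x)=\mathbf S_{\rm prin}(x,A(x))$, where $$\mathbf S_{\rm csub}=\mathbf S_{\rm sub}+\tfrac i{16}\,\mathbf g_{\alpha\beta}\{\mathbf S_{\rm prin},\operatorname{adj}\mathbf S_{\rm prin},\mathbf S_{\rm prin}\}_{p_\alpha p_\beta},\qquad\{F,G,H\}=F_{x^\alpha}GH_{p_\alpha}-F_{p_\alpha}GH_{x^\alpha},$$ and $\operatorname{adj}$ is matrix adjugation. * *Topological charge.* Let $$s^1=\begin{pmatrix}0&1\\1&0\end{pmatrix},\quad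 s^2=\begin{pmatrix}0&-i\\i&0\end{pmatrix},\quad s^3=\begin{pmatrix}1&0\\0&-1\end{pmatrix},\quad s^4=\begin{pmatrix}1&0\\0&1\end{pmatrix},$$ and let $e_j$ be the vector fields determined by $\mathbf S_{\rm prin}(x,p)=\rho(x)\,s^j\,e_j{}^\alpha(x)\,p_\alpha$. For a fixed orientation of $M$, the topological charge is $c_{\rm top}=\operatorname{sgn}\det(e_j{}^\alpha)$, computed in positively oriented coordinates. * *Temporal charge.* For a fixed smooth covector field $q$, the temporal charge is $c_{\rm tem}=\operatorname{sgn}t(q)$, where $t(p)=\rho^{-1}\operatorname{tr}\mathbf S_{\rm prin}(x,p)$. * *Spin structure.* This is the class of symbols $[\mathbf S]=\{\tilde{\mathbf S}\mid\tilde{\mathbf S}_{\rm prin}=R^*\mathbf S_{\rm prin}R\text{ for some }R\in C^\infty(M,SL(2,\mathbb C))\}$. **Theorem.** Let $\mathbf S_{\rm full}$ and $\tilde{\mathbf S}_{\rm full}$ be two full symbols on $M$. Fix an orientation of $M$ and a smooth covector field $q$ that is timelike for the metric encoded within $\mathbf S_{\rm full}$, that is, $g^{\alpha\beta}q_\alpha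 q_\beta<0$ everywhere. Then $\mathbf S_{\rm full}$ and $\tilde{\mathbf S}_{\rm full}$ are $SL$-equivalent if and only if 1. the metrics encoded within them are the same, 2. the electromagnetic covector potentials encoded within them are the same, 3. their topological charges are the same, 4. their temporal charges are the same, and 5. they have the same spin structure. -/

import Mathlib

open scoped Manifold ContDiff Matrix

noncomputable section

namespace SesqForm

/-- `ℝ⁴`: the space of local coordinates `x`, and also of momenta `p`. -/
abbrev R4 := EuclideanSpace ℝ (Fin 4)

/-- Complex `2 × 2` matrices. -/
abbrev Mat2 := Matrix (Fin 2) (Fin 2) ℂ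

/-- The partial derivative `∂f/∂x^α` of a matrix-function, taken entry by entry. -/
def pderiv (α : Fin 4) (f : R4 → Mat2) (x : R4) : Mat2 :=
  Matrix.of fun i j => fderiv ℝ (fun z => f z i j) x (EuclideanSpace.single α 1)

theorem pderiv_conjTranspose (α : Fin 4) (f : R4 → Mat2) (x : R4) :
    pderiv α (fun z => (f z)ᴴ) x = (pderiv α f x)ᴴ := by
  ext i j
  simp only [pderiv, Matrix.conjTranspose_apply, Matrix.of_apply]
  rw [fderiv_star]
  rfl

theorem pderiv_neg (α : Fin 4) (f : R4 → Mat2) (x : R4) :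
    pderiv α (fun z => -f z) x = -pderiv α f x := by
  ext i j
  simp [pderiv]

theorem pderiv_congr (α : Fin 4) {f g : R4 → Mat2} {x : R4}
    (h : ∀ᶠ z in nhds x, f z = g z) : pderiv α f x = pderiv α g x := by
  ext i j
  simp only [pderiv, Matrix.of_apply]
  rw [Filter.EventuallyEq.fderiv_eq]
  filter_upwards [h] with z hz
  rw [hz]

section Manifold

variable (M : Type*) [TopologicalSpace M] [ChartedSpace R4 M]

/-- Local coordinates on `M`: the charts of the maximal smooth atlas. -/
abbrev Coord := {φ : OpenPartialHomeomorph M R4 // φ ∈ IsManifold.maximalAtlas (𝓡 4) ∞ M}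

variable {M}

/-- `y` is the `φ`-coordinate of a point at which the coordinates `ψ` are defined as well. -/
def Overlap (φ ψ : Coord M) (y : R4) : Prop :=
  y ∈ φ.1.target ∧ φ.1.symm y ∈ ψ.1.source

/-- The change of coordinates from `φ` to `ψ`. -/
def change (φ ψ : Coord M) (y : R4) : R4 := ψ.1 (φ.1.symm y)

/-- The Jacobian matrix of the change of coordinates: the entry `β α` is
`∂(ψ-coordinate β)/∂(φ-coordinate α)`. -/
def jacobian (φ ψ : Coord M) (y : R4) : Matrix (Fin 4) (Fin 4) ℝ :=
  Matrix.of fun β α => fderiv ℝ (change φ ψ) y (EuclideanSpace.single α 1) β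

variable (M)

/-- An orientation of `M`, given by an atlas of positively oriented coordinates. -/
structure Orientation where
  charts : Set (Coord M)
  cover : ∀ x : M, ∃ φ ∈ charts, x ∈ φ.1.source
  compatible : ∀ φ ∈ charts, ∀ ψ ∈ charts, ∀ y, Overlap φ ψ y → 0 < (jacobian φ ψ y).det

/-- A smooth real covector field, given by its components `comp φ α` in local coordinates `φ`. -/
structure CovectorField where
  comp : Coord M → Fin 4 → R4 → ℝ
  smooth : ∀ φ α, ContDiffOn ℝ ∞ (comp φ α) φ.1.target
  transform : ∀ φ ψ y, Overlap φ ψ y → ∀ α,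
    comp φ α y = ∑ β, jacobian φ ψ y β α * comp ψ β (change φ ψ y)

/-- A non-degenerate Hermitian full symbol `S_full(x, p) = E^α(x) p_α + F(x)`, i.e. a
non-degenerate Hermitian first order sesquilinear form
`S(u, v) = ∫ [-(i/2) u* E^α v_{x^α} + (i/2) u_{x^α}* E^α v + u* F v] dx`
on compactly supported smooth functions `M → ℂ²`. In local coordinates `φ` the coefficients are
the smooth matrix-functions `E φ α` and `F φ`; the `E^α` form a vector density and `F` is a
density. -/
structure FullSymbol where
  E : Coord M → Fin 4 → R4 → Mat2
  F : Coord M → R4 → Mat2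
  smooth_E : ∀ φ α i j, ContDiffOn ℝ ∞ (fun y => E φ α y i j) φ.1.target
  smooth_F : ∀ φ i j, ContDiffOn ℝ ∞ (fun y => F φ y i j) φ.1.target
  transform_E : ∀ φ ψ y, Overlap φ ψ y → ∀ β,
    E ψ β (change φ ψ y) = |(jacobian φ ψ y).det|⁻¹ • ∑ α, jacobian φ ψ y β α • E φ α y
  transform_F : ∀ φ ψ y, Overlap φ ψ y →
    F ψ (change φ ψ y) = |(jacobian φ ψ y).det|⁻¹ • F φ y
  hermitian_E : ∀ φ α, ∀ y ∈ φ.1.target, (E φ α y).IsHermitian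
  hermitian_F : ∀ φ, ∀ y ∈ φ.1.target, (F φ y).IsHermitian
  nondegenerate : ∀ φ, ∀ y ∈ φ.1.target, ∀ p : R4, p ≠ 0 → ∑ α, p α • E φ α y ≠ 0

/-- A smooth matrix-function `R : M → SL(2, ℂ)`. -/
def SmoothSL (R : M → Matrix.SpecialLinearGroup (Fin 2) ℂ) : Prop :=
  ∀ i j, ContMDiff (𝓡 4) 𝓘(ℝ, ℂ) ∞ (fun x => (R x).1 i j)

variable {M}

/-- A matrix-function on `M` written in local coordinates. -/
def inCoord (φ : Coord M) (R : M → Matrix.SpecialLinearGroup (Fin 2) ℂ) (y : R4) : Mat2 :=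
  (R (φ.1.symm y)).1

namespace FullSymbol

/-- The principal symbol `S_prin(x, p) = E^α(x) p_α`. -/
def prin (S : FullSymbol M) (φ : Coord M) (y p : R4) : Mat2 := ∑ α, p α • S.E φ α y

/-- The subprincipal symbol. -/
def sub (S : FullSymbol M) (φ : Coord M) (y : R4) : Mat2 := S.F φ y

/-- The full symbol `S_full(x, p)`. -/
def full (S : FullSymbol M) (φ : Coord M) (y p : R4) : Mat2 := S.prin φ y p + S.sub φ y

/-- `SL`-equivalence of full symbols:
`S̃_full = R* S_full R + (i/2) [R*_{x^α} (S_full)_{p_α} R - R* (S_full)_{p_α} R_{x^α}]`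
for some smooth `R : M → SL(2, ℂ)`. -/
def SLEquiv (S S' : FullSymbol M) : Prop :=
  ∃ R : M → Matrix.SpecialLinearGroup (Fin 2) ℂ, SmoothSL M R ∧
    ∀ φ : Coord M, ∀ y ∈ φ.1.target, ∀ p : R4,
      S'.full φ y p =
        (inCoord φ R y)ᴴ * S.full φ y p * inCoord φ R y
        + (Complex.I / 2) • ∑ α,
          (pderiv α (fun z => (inCoord φ R z)ᴴ) y * pderiv α (S.full φ y) p * inCoord φ R y
            - (inCoord φ R y)ᴴ * pderiv α (S.full φ y) p * pderiv α (inCoord φ R) y)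

/-- The contravariant metric density, i.e. the real symmetric matrix with
`det S_prin(x, p) = - ∑ gDens α β p_α p_β`, obtained from the quadratic form by polarization. -/
def gDens (S : FullSymbol M) (φ : Coord M) (y : R4) : Matrix (Fin 4) (Fin 4) ℝ :=
  Matrix.of fun α β => -(1 / 2) *
    ((S.E φ α y + S.E φ β y).det - (S.E φ α y).det - (S.E φ β y).det).re

/-- The Lorentzian density `ρ = (- det gDens)^(1/6)`. -/
def rho (S : FullSymbol M) (φ : Coord M) (y : R4) : ℝ := (-(S.gDens φ y).det) ^ (1 / 6 : ℝ)

/-- The contravariant Lorentzian metric `g^{αβ} = ρ⁻² gDens^{αβ}`. -/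
def metric (S : FullSymbol M) (φ : Coord M) (y : R4) : Matrix (Fin 4) (Fin 4) ℝ :=
  (S.rho φ y ^ 2)⁻¹ • S.gDens φ y

end FullSymbol

/-- The generalised Poisson bracket
`{F, G, H} = F_{x^γ} G H_{p_γ} - F_{p_γ} G H_{x^γ}` of matrix-functions of `(x, p)`. -/
def bracket (F G H : R4 → R4 → Mat2) (y p : R4) : Mat2 :=
  ∑ γ, (pderiv γ (fun z => F z p) y * G y p * pderiv γ (H y) p
    - pderiv γ (F y) p * G y p * pderiv γ (fun z => H z p) y)

namespace FullSymbol

/-- The covariant subprincipal symbol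
`S_csub = S_sub + (i/16) g_{αβ} {S_prin, adj S_prin, S_prin}_{p_α p_β}`, where `g_{αβ}` is the
inverse of `gDens`. The bracket is a quadratic form in `p`, so that its second derivatives do not
depend on the momentum; they are taken at `p = 0`. -/
def csub (S : FullSymbol M) (φ : Coord M) (y : R4) : Mat2 :=
  S.sub φ y + (Complex.I / 16) • ∑ α, ∑ β, (S.gDens φ y)⁻¹ α β •
    pderiv α (pderiv β
      (bracket (S.prin φ) (fun z p => (S.prin φ z p).adjugate) (S.prin φ) y)) 0

end FullSymbol

/-- The standard basis `s^1, s^2, s^3, s^4` of the Hermitian `2 × 2` matrices. -/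
def pauli : Fin 4 → Mat2 :=
  ![!![0, 1; 1, 0], !![0, -Complex.I; Complex.I, 0], !![1, 0; 0, -1], !![1, 0; 0, 1]]

/-- The real coefficients of a Hermitian matrix in the basis `pauli`. -/
def coeff (A : Mat2) (j : Fin 4) : ℝ := (1 / 2) * ((pauli j * A).trace).re

theorem eq_sum_coeff {A : Mat2} (hA : A.IsHermitian) : A = ∑ j, coeff A j • pauli j := by
  have h00 := congrArg Complex.im (hA.apply 0 0)
  have h11 := congrArg Complex.im (hA.apply 1 1)
  have h01 := hA.apply 0 1
  have hr := congrArg Complex.re h01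
  have hi := congrArg Complex.im h01
  simp at h00 h11 hr hi
  ext i j
  fin_cases i <;> fin_cases j <;> apply Complex.ext <;>
    simp [coeff, pauli, Fin.sum_univ_four, Matrix.trace_fin_two, Matrix.mul_apply,
      Fin.sum_univ_two] <;> linarith

theorem sum_coeff_smul (c : Fin 4 → ℝ) (A : Fin 4 → Mat2) (j : Fin 4) :
    coeff (∑ α, c α • A α) j = ∑ α, c α * coeff (A α) j := by
  simp only [coeff, Matrix.trace_sum, Complex.re_sum, Finset.mul_sum,
    Matrix.mul_smul, Matrix.trace_smul, Complex.smul_re, smul_eq_mul]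
  exact Finset.sum_congr rfl fun α _ => by ring

namespace FullSymbol

/-- The framing `e_j = (e_j^α)`, determined by `S_prin(x, p) = ρ(x) s^j e_j^α(x) p_α`. -/
def frame (S : FullSymbol M) (φ : Coord M) (y : R4) : Matrix (Fin 4) (Fin 4) ℝ :=
  Matrix.of fun j α => (S.rho φ y)⁻¹ * coeff (S.E φ α y) j

theorem det_prin (S : FullSymbol M) (φ : Coord M) {y : R4} (hy : y ∈ φ.1.target) (p : R4) :
    (S.prin φ y p).det = ((-∑ α, ∑ β, S.gDens φ y α β * p α * p β : ℝ) : ℂ) := by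
  have h00 := fun α => congrArg Complex.im ((S.hermitian_E φ α y hy).apply 0 0)
  have h11 := fun α => congrArg Complex.im ((S.hermitian_E φ α y hy).apply 1 1)
  have hr := fun α => congrArg Complex.re ((S.hermitian_E φ α y hy).apply 0 1)
  have hi := fun α => congrArg Complex.im ((S.hermitian_E φ α y hy).apply 0 1)
  simp at h00 h11 hr hi
  have e00 : ∀ α, (S.E φ α y 0 0).im = 0 := fun α => by linarith [h00 α]
  have e11 : ∀ α, (S.E φ α y 1 1).im = 0 := fun α => by linarith [h11 α]
  apply Complex.ext <;>
    simp [prin, gDens, Matrix.det_fin_two, Fin.sum_univ_four, e00, e11, hr, ← hi] <;> ring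

theorem prin_isHermitian (S : FullSymbol M) (φ : Coord M) {y : R4} (hy : y ∈ φ.1.target)
    (p : R4) : (S.prin φ y p).IsHermitian := by
  simp only [Matrix.IsHermitian, prin, Matrix.conjTranspose_sum, Matrix.conjTranspose_smul,
    star_trivial]
  exact Finset.sum_congr rfl fun α _ => by rw [(S.hermitian_E φ α y hy).eq]

theorem csub_isHermitian (S : FullSymbol M) (φ : Coord M) {y : R4} (hy : y ∈ φ.1.target) :
    (S.csub φ y).IsHermitian := by
  have hx : ∀ γ p, (pderiv γ (fun z => S.prin φ z p) y)ᴴ = pderiv γ (fun z => S.prin φ z p) y := by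
    intro γ p
    rw [← pderiv_conjTranspose]
    refine pderiv_congr γ ?_
    filter_upwards [φ.1.open_target.mem_nhds hy] with z hz
    exact S.prin_isHermitian φ hz p
  have hp : ∀ γ p, (pderiv γ (S.prin φ y) p)ᴴ = pderiv γ (S.prin φ y) p := by
    intro γ p
    rw [← pderiv_conjTranspose]
    exact pderiv_congr γ (Filter.Eventually.of_forall fun r => S.prin_isHermitian φ hy r)
  have ha : ∀ p, ((S.prin φ y p).adjugate)ᴴ = (S.prin φ y p).adjugate := by
    intro p
    rw [Matrix.adjugate_conjTranspose, (S.prin_isHermitian φ hy p).eq]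
  have hb : ∀ p, (bracket (S.prin φ) (fun z p => (S.prin φ z p).adjugate) (S.prin φ) y p)ᴴ
      = -bracket (S.prin φ) (fun z p => (S.prin φ z p).adjugate) (S.prin φ) y p := by
    intro p
    simp only [bracket, Matrix.conjTranspose_sum, Matrix.conjTranspose_sub,
      Matrix.conjTranspose_mul, hx, hp, ha, ← Finset.sum_neg_distrib, neg_sub, mul_assoc]
  unfold csub
  generalize bracket (S.prin φ) (fun z p => (S.prin φ z p).adjugate) (S.prin φ) y = B at hb
  have hd : ∀ (f : R4 → Mat2), (∀ p, (f p)ᴴ = -f p) → ∀ γ p, (pderiv γ f p)ᴴ = -pderiv γ f p := by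
    intro f hf γ p
    rw [← pderiv_conjTranspose, ← pderiv_neg]
    exact pderiv_congr γ (Filter.Eventually.of_forall hf)
  have h2 : ∀ α β p, (pderiv α (pderiv β B) p)ᴴ = -pderiv α (pderiv β B) p :=
    fun α β => hd _ (hd _ hb β) α
  have hI : star (Complex.I / 16) = -(Complex.I / 16) := by
    apply Complex.ext <;> norm_num
  simp only [Matrix.IsHermitian, Matrix.conjTranspose_add, Matrix.conjTranspose_sum,
    Matrix.conjTranspose_smul, star_trivial, h2, hI, sub, (S.hermitian_F φ y hy).eq,
    smul_neg, Finset.sum_neg_distrib, neg_smul, neg_neg]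

/-- A Hermitian matrix is the value of the principal symbol at exactly one momentum. -/
theorem existsUnique_prin_eq (S : FullSymbol M) (φ : Coord M) {y : R4} (hy : y ∈ φ.1.target)
    {A : Mat2} (hA : A.IsHermitian) : ∃! p : R4, A = S.prin φ y p := by
  let T : R4 →ₗ[ℝ] (Fin 4 → ℝ) :=
    { toFun := fun p j => ∑ α, p α * coeff (S.E φ α y) j
      map_add' := fun p r => by
        ext j; simp [add_mul, Finset.sum_add_distrib]
      map_smul' := fun c p => by
        ext j; simp [Finset.mul_sum, mul_assoc] }
  have hT : ∀ p, T p = coeff (S.prin φ y p) := fun p => by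
    ext j
    exact (sum_coeff_smul (fun α => p α) (fun α => S.E φ α y) j).symm
  have hinj : Function.Injective T := by
    refine (injective_iff_map_eq_zero T).2 fun p h0 => ?_
    by_contra hne
    refine S.nondegenerate φ y hy p hne ?_
    have := eq_sum_coeff (S.prin_isHermitian φ hy p)
    rw [← hT, h0] at this
    simpa [prin] using this
  have hsurj : Function.Surjective T :=
    (LinearMap.injective_iff_surjective_of_finrank_eq_finrank (by simp)).1 hinj
  obtain ⟨p, hp⟩ := hsurj (coeff A)
  refine ⟨p, ?_, fun r (hr : A = _) => hinj ?_⟩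
  · calc A = ∑ j, coeff A j • pauli j := eq_sum_coeff hA
      _ = ∑ j, coeff (S.prin φ y p) j • pauli j := by rw [← hT, hp]
      _ = S.prin φ y p := (eq_sum_coeff (S.prin_isHermitian φ hy p)).symm
  · rw [hT, ← hr, hp]

/-- The metric density has negative determinant, so that `rho` is positive. -/
theorem det_gDens_neg (S : FullSymbol M) (φ : Coord M) {y : R4} (hy : y ∈ φ.1.target) :
    (S.gDens φ y).det < 0 := by
  let C : Matrix (Fin 4) (Fin 4) ℝ := Matrix.of fun α j => coeff (S.E φ α y) j
  have hE : ∀ α, S.E φ α y = ∑ j, C α j • pauli j := fun α =>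
    eq_sum_coeff (S.hermitian_E φ α y hy)
  have hg : S.gDens φ y = C * Matrix.diagonal ![1, 1, 1, -1] * Cᵀ := by
    ext α β
    simp only [gDens, hE, Matrix.of_apply, Matrix.mul_apply, Matrix.transpose_apply]
    generalize C = D
    simp [Fin.sum_univ_four, pauli, Matrix.det_fin_two]
    ring
  have hC : C.det ≠ 0 := by
    intro h0
    obtain ⟨v, hv, h⟩ := Matrix.exists_vecMul_eq_zero_iff.2 h0
    refine S.nondegenerate φ y hy (WithLp.toLp 2 v) (by simpa using hv) ?_
    have hh := eq_sum_coeff (S.prin_isHermitian φ hy (WithLp.toLp 2 v))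
    have hz : ∀ j, coeff (S.prin φ y (WithLp.toLp 2 v)) j = 0 := fun j =>
      (sum_coeff_smul _ _ j).trans (congrFun h j)
    simp only [hz, zero_smul, Finset.sum_const_zero] at hh
    exact hh
  rw [hg, Matrix.det_mul, Matrix.det_mul, Matrix.det_transpose, Matrix.det_diagonal]
  have : 0 < C.det * C.det := mul_self_pos.2 hC
  have hd : ∏ i, (![1, 1, 1, -1] : Fin 4 → ℝ) i = -1 := by simp [Fin.prod_univ_four]
  rw [hd]
  linarith

theorem prin_eq_frame (S : FullSymbol M) (φ : Coord M) {y : R4} (hy : y ∈ φ.1.target) (p : R4) :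
    S.prin φ y p = S.rho φ y • ∑ j, ∑ α, (S.frame φ y j α * p α) • pauli j := by
  have hr : S.rho φ y ≠ 0 :=
    (Real.rpow_pos_of_pos (neg_pos.2 (S.det_gDens_neg φ hy)) _).ne'
  rw [eq_sum_coeff (S.prin_isHermitian φ hy p), Finset.smul_sum]
  refine Finset.sum_congr rfl fun j _ => ?_
  rw [← Finset.sum_smul, smul_smul]
  congr 1
  rw [Finset.mul_sum]
  refine (sum_coeff_smul _ _ j).trans (Finset.sum_congr rfl fun α _ => ?_)
  simp only [frame, Matrix.of_apply]
  field_simp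

/-- The electromagnetic covector potential at the point with `φ`-coordinate `y`: the unique real
solution `A` of `S_csub(x) = S_prin(x, A)`. -/
def potential (S : FullSymbol M) (φ : Coord M) (y : φ.1.target) : R4 :=
  (S.existsUnique_prin_eq φ y.2 (S.csub_isHermitian φ y.2)).choose

/-- The topological charge `sgn det (e_j^α)`, computed in positively oriented local coordinates:
the orientation of the framing relative to the orientation of `M`. -/
def topCharge (S : FullSymbol M) (φ : Coord M) (y : R4) : SignType :=
  SignType.sign (S.frame φ y).det

/-- The covector field `q` is timelike with respect to the metric encoded within `S`. -/
def IsTimelike (S : FullSymbol M) (q : CovectorField M) : Prop :=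
  ∀ φ : Coord M, ∀ y ∈ φ.1.target,
    ∑ α, ∑ β, S.metric φ y α β * q.comp φ α y * q.comp φ β y < 0

/-- The temporal charge `sgn t(q)`, where `t(p) = ρ⁻¹ tr S_prin(x, p)`. -/
def temCharge (S : FullSymbol M) (q : CovectorField M) (φ : Coord M) (y : R4) : SignType :=
  SignType.sign ((S.rho φ y)⁻¹ *
    ((S.prin φ y (WithLp.toLp 2 fun α => q.comp φ α y)).trace).re)

/-- The spin structure: the class `{S̃ | S̃_prin = R* S_prin R for some smooth R : M → SL(2, ℂ)}`
of the symbol. -/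
def spinStructure (S : FullSymbol M) : Set (FullSymbol M) :=
  {S' | ∃ R : M → Matrix.SpecialLinearGroup (Fin 2) ℂ, SmoothSL M R ∧
    ∀ φ : Coord M, ∀ y ∈ φ.1.target, ∀ p : R4,
      S'.prin φ y p = (inCoord φ R y)ᴴ * S.prin φ y p * inCoord φ R y}

end FullSymbol

end Manifold

end SesqForm

end

/-!
A matrix-function `R : M → SL(2, ℂ)` acts on full symbols by gauge transformations. On the principal
symbol the action is `A ↦ R* A R`; on the subprincipal symbol it has in addition an inhomogeneous
term containing the derivatives of `R`. The correction term in the definition of `csub` is built so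
that it absorbs this inhomogeneous term: `csub` again transforms as `A ↦ R* A R`. So a gauge
transformation between two symbols is the same thing as a smooth `R` which carries both
`S_prin` to `S'_prin` and `S_csub` to `S'_csub` (`slEquiv_iff`). A smooth `R` with the first property
exists exactly when the spin structures coincide (`spinStructure_eq_iff`), the classes of symbols
being orbits of a group. Given such an `R`, the second property says that the potentials coincide
(`PrinGauge.potential_eq_iff`), because `S_csub = S_prin(A)` and `A` is determined by this equation.

The transformation law of `csub` is `PrinGauge.csub_eq`. In coordinates, the correction term is
`(i/8) g_{αβ} (E^α_{x^γ} adj(E^β) E^γ - E^γ adj(E^β) E^α_{x^γ})` (`csub_eq`). Substituting `R* E^α R`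
for `E^α` yields, besides the expected `R* (⋯) R`, terms with derivatives of `R`. They are evaluated
by the Fierz identity `g_{αβ} E^α X adj(E^β) = -2 (tr X) I` (`sum_E_mul_adjugate`), which holds
because in terms of the Pauli basis `g_{αβ}` is the Minkowski matrix. With `X = R_{x^γ} R⁻¹`, which is
trace-free as a tangent vector of `SL(2, ℂ)`, the identity kills one half of these terms; with
`X = I` it turns the other half into a multiple of the inhomogeneous term.

The metric and the charges are invariant under `A ↦ R* A R`: the metric since the determinant is;
the topological charge since this linear map of Hermitian matrices has determinant
`|det R|⁴ = 1` (`det_lorentz`); the temporal charge since `S_prin(q)` is definite for a timelike `q`,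
and the sign of the trace of a definite matrix is preserved (`sign_trace_conjTranspose_mul_mul`).
-/

open scoped Kronecker

namespace SesqForm

/-! ### Entrywise partial derivatives -/

theorem pderiv_mul (α : Fin 4) {f g : R4 → Mat2} {x : R4}
    (hf : ∀ i j, DifferentiableAt ℝ (fun z => f z i j) x)
    (hg : ∀ i j, DifferentiableAt ℝ (fun z => g z i j) x) :
    pderiv α (fun z => f z * g z) x = pderiv α f x * g x + f x * pderiv α g x := by
  ext i j
  simp only [pderiv, Matrix.of_apply, Matrix.mul_apply, Matrix.add_apply, Fin.sum_univ_two]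
  rw [fderiv_fun_add ((hf i 0).fun_mul (hg 0 j)) ((hf i 1).fun_mul (hg 1 j)),
    fderiv_fun_mul (hf i 0) (hg 0 j), fderiv_fun_mul (hf i 1) (hg 1 j)]
  simp
  ring

theorem differentiableAt_mul_apply {f g : R4 → Mat2} {x : R4}
    (hf : ∀ i j, DifferentiableAt ℝ (fun z => f z i j) x)
    (hg : ∀ i j, DifferentiableAt ℝ (fun z => g z i j) x) (i j : Fin 2) :
    DifferentiableAt ℝ (fun z => (f z * g z) i j) x := by
  simp only [Matrix.mul_apply, Fin.sum_univ_two]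
  exact ((hf i 0).fun_mul (hg 0 j)).fun_add ((hf i 1).fun_mul (hg 1 j))

theorem pderiv_sum_smul (α : Fin 4) (c : Fin 4 → ℝ) {f : Fin 4 → R4 → Mat2} {x : R4}
    (hf : ∀ a i j, DifferentiableAt ℝ (fun z => f a z i j) x) :
    pderiv α (fun z => ∑ a, c a • f a z) x = ∑ a, c a • pderiv α (f a) x := by
  ext i j
  simp only [pderiv, Matrix.of_apply, Matrix.sum_apply, Matrix.smul_apply]
  rw [fderiv_fun_sum fun a _ => (hf a i j).fun_const_smul (c a)]
  simp only [FunLike.coe_sum, Finset.sum_apply]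
  refine Finset.sum_congr rfl fun a _ => ?_
  rw [fderiv_fun_const_smul (hf a i j)]
  rfl

theorem hasFDerivAt_coord (a : Fin 4) (p : R4) :
    HasFDerivAt (fun z : R4 => z a) (EuclideanSpace.proj a : R4 →L[ℝ] ℝ) p :=
  (EuclideanSpace.proj a : R4 →L[ℝ] ℝ).hasFDerivAt

theorem pderiv_linear (α : Fin 4) (A : Fin 4 → Mat2) (p : R4) :
    pderiv α (fun z => ∑ a, z a • A a) p = A α := by
  ext i j
  simp only [pderiv, Matrix.of_apply, Matrix.sum_apply, Matrix.smul_apply]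
  have h : HasFDerivAt (fun z : R4 => ∑ a, z a • A a i j) _ p :=
    HasFDerivAt.fun_sum fun a _ => (hasFDerivAt_coord a p).smul_const (A a i j)
  rw [h.fderiv]
  simp

theorem pderiv_add_const (α : Fin 4) (f : R4 → Mat2) (A : Mat2) (p : R4) :
    pderiv α (fun z => f z + A) p = pderiv α f p := by
  ext i j
  simp [pderiv]

/-- The derivative of a quadratic form; no symmetry of the coefficients is needed. -/
theorem pderiv_quadratic (β : Fin 4) (Q : Fin 4 → Fin 4 → Mat2) :
    pderiv β (fun z => ∑ a, ∑ b, (z a * z b) • Q a b)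
      = fun p => ∑ a, p a • (Q a β + Q β a) := by
  funext p
  ext i j
  simp only [pderiv, Matrix.of_apply, Matrix.sum_apply, Matrix.smul_apply, Matrix.add_apply]
  have h : HasFDerivAt (fun z : R4 => ∑ a, ∑ b, (z a * z b) • Q a b i j) _ p :=
    HasFDerivAt.fun_sum fun a _ => HasFDerivAt.fun_sum fun b _ =>
      ((hasFDerivAt_coord a p).mul (hasFDerivAt_coord b p)).smul_const (Q a b i j)
  rw [h.fderiv]
  simp [add_smul, Finset.sum_add_distrib]

/-! ### Matrix algebra -/

theorem adjugate_sum_smul (c : Fin 4 → ℝ) (A : Fin 4 → Mat2) :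
    (∑ a, c a • A a).adjugate = ∑ a, c a • (A a).adjugate := by
  ext i j
  fin_cases i <;> fin_cases j <;>
    simp [Matrix.adjugate_fin_two, Matrix.sum_apply]

theorem adjugate_add (A B : Mat2) : (A + B).adjugate = A.adjugate + B.adjugate := by
  ext i j
  fin_cases i <;> fin_cases j <;> simp [Matrix.adjugate_fin_two, add_comm]

theorem adjugate_real_smul (c : ℝ) (A : Mat2) : (c • A).adjugate = c • A.adjugate := by
  ext i j
  fin_cases i <;> fin_cases j <;> simp [Matrix.adjugate_fin_two]

theorem mul_adjugate_of_det_eq_one {A : Mat2} (h : A.det = 1) : A * A.adjugate = 1 := by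
  rw [Matrix.mul_adjugate, h, one_smul]

theorem det_conjTranspose_mul_mul {R : Mat2} (hR : R.det = 1) (A : Mat2) :
    (Rᴴ * A * R).det = A.det := by
  simp [Matrix.det_mul, Matrix.det_conjTranspose, hR]

theorem adjugate_conjTranspose_mul_mul (R A : Mat2) :
    (Rᴴ * A * R).adjugate = R.adjugate * A.adjugate * Rᴴ.adjugate := by
  rw [Matrix.adjugate_mul_distrib, Matrix.adjugate_mul_distrib, mul_assoc]

theorem conjTranspose_mul_mul_cancel {R A B : Mat2} (hR : R.det = 1) (h : Rᴴ * A * R = B) :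
    A = R.adjugateᴴ * B * R.adjugate := by
  have h1 := mul_adjugate_of_det_eq_one hR
  have h2 : R.adjugateᴴ * Rᴴ = 1 := by
    rw [← Matrix.conjTranspose_mul, h1, Matrix.conjTranspose_one]
  calc A = (R.adjugateᴴ * Rᴴ) * A * (R * R.adjugate) := by rw [h1, h2, one_mul, mul_one]
    _ = _ := by rw [← h]; simp only [mul_assoc]

/-- The tangent space of `SL(2, ℂ)`: a derivative `R'` of `R` satisfies `tr (R' R⁻¹) = 0`. -/
theorem trace_pderiv_mul_adjugate (α : Fin 4) {f : R4 → Mat2} {x : R4}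
    (hf : ∀ i j, DifferentiableAt ℝ (fun z => f z i j) x) (hdet : ∀ z, (f z).det = 1) :
    (pderiv α f x * (f x).adjugate).trace = 0 := by
  have h : fderiv ℝ (fun z => (f z).det) x (EuclideanSpace.single α 1) = 0 := by
    simp only [hdet]; simp
  simp only [Matrix.det_fin_two] at h
  rw [fderiv_fun_sub ((hf 0 0).fun_mul (hf 1 1)) ((hf 0 1).fun_mul (hf 1 0)),
    fderiv_fun_mul (hf 0 0) (hf 1 1), fderiv_fun_mul (hf 0 1) (hf 1 0)] at h
  simp only [FunLike.coe_sub, FunLike.coe_add, Pi.sub_apply, Pi.add_apply, FunLike.coe_smul,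
    Pi.smul_apply, smul_eq_mul] at h
  simp only [Matrix.trace_fin_two, Matrix.mul_apply, Fin.sum_univ_two, Matrix.adjugate_fin_two,
    pderiv, Matrix.of_apply, Matrix.cons_val_zero, Matrix.cons_val_one]
  linear_combination h

/-- The Fierz identity for the Pauli matrices. -/
theorem sum_pauli_mul_adjugate (X : Mat2) :
    ∑ j, (![1, 1, 1, -1] : Fin 4 → ℝ) j • (pauli j * X * (pauli j).adjugate)
      = (-2 * X.trace) • (1 : Mat2) := by
  rw [Matrix.eta_fin_two X]
  ext i j
  fin_cases i <;> fin_cases j <;> apply Complex.ext <;>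
    simp [Fin.sum_univ_four, pauli, Matrix.adjugate_fin_two, Matrix.trace_fin_two] <;> ring

theorem sum_adjugate_pauli_mul (X : Mat2) :
    ∑ j, (![1, 1, 1, -1] : Fin 4 → ℝ) j • ((pauli j).adjugate * X * pauli j)
      = (-2 * X.trace) • (1 : Mat2) := by
  rw [Matrix.eta_fin_two X]
  ext i j
  fin_cases i <;> fin_cases j <;> apply Complex.ext <;>
    simp [Fin.sum_univ_four, pauli, Matrix.adjugate_fin_two, Matrix.trace_fin_two] <;> ring

/-- The matrix, in the basis `pauli`, of the action `A ↦ R* A R` on Hermitian matrices. -/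
noncomputable def lorentz (R : Mat2) : Matrix (Fin 4) (Fin 4) ℝ :=
  Matrix.of fun j k => coeff (Rᴴ * pauli k * R) j

theorem pauli_isHermitian (k : Fin 4) : (pauli k).IsHermitian := by
  ext i j
  fin_cases k <;> fin_cases i <;> fin_cases j <;> simp [pauli]

/-- Over `ℂ`, the action `A ↦ R* A R` on Hermitian matrices becomes the Kronecker product of `R*`
and `Rᵀ`, whose determinant is `(conj (det R))² (det R)²`. -/
theorem det_lorentz {R : Mat2} (hR : R.det = 1) : (lorentz R).det = 1 := by
  let P : Matrix (Fin 2 × Fin 2) (Fin 4) ℂ := Matrix.of fun ij k => pauli k ij.1 ij.2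
  let Q : Matrix (Fin 4) (Fin 2 × Fin 2) ℂ := Matrix.of fun k ij => (1 / 2) * pauli k ij.2 ij.1
  have hQP : Q * P = 1 := by
    ext i j
    fin_cases i <;> fin_cases j <;> apply Complex.ext <;>
      simp [P, Q, pauli, Matrix.mul_apply, Fintype.sum_prod_type, Fin.sum_univ_two] <;> norm_num
  have hPQ : P * Q = 1 := by
    ext ⟨i, i'⟩ ⟨j, j'⟩
    fin_cases i <;> fin_cases i' <;> fin_cases j <;> fin_cases j' <;>
      apply Complex.ext <;> simp [P, Q, pauli, Matrix.mul_apply, Fin.sum_univ_four] <;> norm_num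
  have hK : (Rᴴ ⊗ₖ Rᵀ) * P = P * (lorentz R).map Complex.ofRealHom := by
    ext ⟨i, j⟩ k
    have h := congrFun₂ (eq_sum_coeff (A := Rᴴ * pauli k * R) (by
      simp only [Matrix.IsHermitian, Matrix.conjTranspose_mul, Matrix.conjTranspose_conjTranspose,
        (pauli_isHermitian k).eq, mul_assoc])) i j
    calc ((Rᴴ ⊗ₖ Rᵀ) * P) (i, j) k = (Rᴴ * pauli k * R) i j := by
          simp [P, Matrix.mul_apply, Fintype.sum_prod_type, Fin.sum_univ_two]
          ring
      _ = _ := by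
          rw [h]
          simp [P, Matrix.mul_apply, lorentz, Matrix.sum_apply, mul_comm]
  have hdet : ((lorentz R).map Complex.ofRealHom).det = (Rᴴ ⊗ₖ Rᵀ).det := by
    rw [← Matrix.det_conj_of_mul_eq_one hQP hPQ, Matrix.mul_assoc Q, hK, ← Matrix.mul_assoc, hQP,
      one_mul]
  rw [Matrix.det_kronecker, Matrix.det_conjTranspose, Matrix.det_transpose, hR,
    ← RingHom.mapMatrix_apply, ← RingHom.map_det] at hdet
  simpa using hdet

/-- Completing the square: for a Hermitian `H` with positive determinant, `H₀₀ · tr (R* H R)` is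
nonnegative. -/
theorem apply_zero_zero_mul_trace_nonneg {H : Mat2} (hH : H.IsHermitian) (hd : 0 < H.det.re)
    (R : Mat2) : 0 ≤ (H 0 0).re * (Rᴴ * H * R).trace.re := by
  have h00 := congrArg Complex.im (hH.apply 0 0)
  have h11 := congrArg Complex.im (hH.apply 1 1)
  have hr := congrArg Complex.re (hH.apply 0 1)
  have hi := congrArg Complex.im (hH.apply 0 1)
  simp at h00 h11 hr hi
  have e00 : (H 0 0).im = 0 := by linarith
  have e11 : (H 1 1).im = 0 := by linarith
  have hi' : (H 1 0).im = -(H 0 1).im := by linarith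
  have key : (H 0 0).re * (Rᴴ * H * R).trace.re
      = Complex.normSq (H 0 0 * R 0 0 + H 0 1 * R 1 0)
        + Complex.normSq (H 0 0 * R 0 1 + H 0 1 * R 1 1)
        + H.det.re * (Complex.normSq (R 1 0) + Complex.normSq (R 1 1)) := by
    simp [Matrix.trace_fin_two, Matrix.mul_apply, Fin.sum_univ_two, Matrix.det_fin_two,
      Complex.normSq_apply, e00, e11, hr, hi']
    ring
  rw [key]
  have := Complex.normSq_nonneg (R 1 0)
  have := Complex.normSq_nonneg (R 1 1)
  have := Complex.normSq_nonneg (H 0 0 * R 0 0 + H 0 1 * R 1 0)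
  have := Complex.normSq_nonneg (H 0 0 * R 0 1 + H 0 1 * R 1 1)
  positivity

/-- `H₀₀ H₁₁ ≥ det H > 0`, so that the two diagonal entries are nonzero and of the same sign. -/
theorem trace_ne_zero_of_det_pos {H : Mat2} (hH : H.IsHermitian) (hd : 0 < H.det.re) :
    (H 0 0).re ≠ 0 ∧ H.trace.re ≠ 0 := by
  have h00 := congrArg Complex.im (hH.apply 0 0)
  have hr := congrArg Complex.re (hH.apply 0 1)
  have hi := congrArg Complex.im (hH.apply 0 1)
  simp at h00 hr hi
  have e00 : (H 0 0).im = 0 := by linarith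
  have hi' : (H 1 0).im = -(H 0 1).im := by linarith
  simp only [Matrix.det_fin_two, Complex.sub_re, Complex.mul_re, e00, hr, hi'] at hd
  have hpos : 0 < (H 0 0).re * (H 1 1).re := by
    nlinarith [sq_nonneg (H 0 1).re, sq_nonneg (H 0 1).im]
  refine ⟨fun h => by simp [h] at hpos, fun h => ?_⟩
  rw [Matrix.trace_fin_two, Complex.add_re] at h
  rw [show (H 1 1).re = -(H 0 0).re by linarith] at hpos
  nlinarith [sq_nonneg (H 0 0).re]

theorem sign_eq_of_mul_nonneg {a b : ℝ} (ha : a ≠ 0) (hb : b ≠ 0) (h : 0 ≤ a * b) :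
    SignType.sign a = SignType.sign b := by
  rcases lt_or_gt_of_ne ha with ha' | ha'
  · have : b < 0 := lt_of_le_of_ne (nonpos_of_mul_nonneg_right h ha') hb
    rw [sign_neg ha', sign_neg this]
  · have : 0 < b := lt_of_le_of_ne (nonneg_of_mul_nonneg_right h ha') hb.symm
    rw [sign_pos ha', sign_pos this]

theorem sign_trace_conjTranspose_mul_mul {H R : Mat2} (hH : H.IsHermitian) (hd : 0 < H.det.re)
    (hR : R.det = 1) :
    SignType.sign (Rᴴ * H * R).trace.re = SignType.sign H.trace.re := by
  have hH' : (Rᴴ * H * R).IsHermitian := by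
    simp only [Matrix.IsHermitian, Matrix.conjTranspose_mul, Matrix.conjTranspose_conjTranspose,
      hH.eq, mul_assoc]
  have h1 := trace_ne_zero_of_det_pos hH hd
  have h2 := trace_ne_zero_of_det_pos hH' (by rwa [det_conjTranspose_mul_mul hR])
  rw [← sign_eq_of_mul_nonneg h1.1 h2.2 (apply_zero_zero_mul_trace_nonneg hH hd R)]
  refine sign_eq_of_mul_nonneg h1.1 h1.2 ?_
  simpa using apply_zero_zero_mul_trace_nonneg hH hd 1

section Manifold

variable {M : Type*} [TopologicalSpace M] [ChartedSpace R4 M]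

/-! ### Matrix-functions in local coordinates -/

theorem det_inCoord (φ : Coord M) (R : M → Matrix.SpecialLinearGroup (Fin 2) ℂ) (y : R4) :
    (inCoord φ R y).det = 1 :=
  (R (φ.1.symm y)).2

theorem SmoothSL.differentiableAt_inCoord [IsManifold (𝓡 4) ∞ M]
    {R : M → Matrix.SpecialLinearGroup (Fin 2) ℂ} (hR : SmoothSL M R) (φ : Coord M) {y : R4}
    (hy : y ∈ φ.1.target) (i j : Fin 2) :
    DifferentiableAt ℝ (fun z => inCoord φ R z i j) y := by
  have h : ContMDiffAt (𝓡 4) 𝓘(ℝ, ℂ) ∞ (fun z => inCoord φ R z i j) y :=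
    (hR i j).contMDiffAt.comp y
      ((contMDiffOn_symm_of_mem_maximalAtlas φ.2).contMDiffAt (φ.1.open_target.mem_nhds hy))
  exact (contMDiffAt_iff_contDiffAt.1 h).differentiableAt (by simp)

theorem SmoothSL.one : SmoothSL M (fun _ => 1) := fun _ _ => contMDiff_const

theorem SmoothSL.mul {R T : M → Matrix.SpecialLinearGroup (Fin 2) ℂ} (hR : SmoothSL M R)
    (hT : SmoothSL M T) : SmoothSL M (fun x => R x * T x) := by
  intro i j
  have : (fun x => (R x * T x).1 i j)
      = fun x => (R x).1 i 0 * (T x).1 0 j + (R x).1 i 1 * (T x).1 1 j := by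
    funext x
    simp [Matrix.mul_apply, Fin.sum_univ_two]
  rw [this]
  have hmul := fun k => (contDiff_mul (𝕜 := ℝ) (𝔸 := ℂ) (n := ∞)).comp_contMDiff
    ((hR i k).prodMk_space (hT k j))
  exact (hmul 0).add (hmul 1)

theorem SmoothSL.inv {R : M → Matrix.SpecialLinearGroup (Fin 2) ℂ} (hR : SmoothSL M R) :
    SmoothSL M (fun x => (R x)⁻¹) := by
  intro i j
  simp only [Matrix.SpecialLinearGroup.coe_inv, Matrix.adjugate_fin_two]
  fin_cases i <;> fin_cases j <;> simp
  · exact hR 1 1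
  · exact (hR 0 1).neg
  · exact (hR 1 0).neg
  · exact hR 0 0

/-! ### Full symbols -/

namespace FullSymbol

theorem differentiableAt_E (S : FullSymbol M) (φ : Coord M) {y : R4} (hy : y ∈ φ.1.target)
    (α : Fin 4) (i j : Fin 2) : DifferentiableAt ℝ (fun z => S.E φ α z i j) y :=
  ((S.smooth_E φ α i j).contDiffAt (φ.1.open_target.mem_nhds hy)).differentiableAt (by simp)

theorem prin_single (S : FullSymbol M) (φ : Coord M) (y : R4) (α : Fin 4) :
    S.prin φ y (EuclideanSpace.single α 1) = S.E φ α y := by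
  simp [prin, PiLp.single_apply]

theorem pderiv_prin (S : FullSymbol M) (φ : Coord M) (y : R4) (α : Fin 4) (p : R4) :
    pderiv α (S.prin φ y) p = S.E φ α y :=
  pderiv_linear α (fun a => S.E φ a y) p

theorem pderiv_full (S : FullSymbol M) (φ : Coord M) (y : R4) (α : Fin 4) (p : R4) :
    pderiv α (S.full φ y) p = S.E φ α y :=
  (pderiv_add_const α (S.prin φ y) (S.sub φ y) p).trans (S.pderiv_prin φ y α p)

theorem gDens_symm (S : FullSymbol M) (φ : Coord M) (y : R4) : (S.gDens φ y)ᵀ = S.gDens φ y := by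
  ext α β
  simp only [gDens, Matrix.transpose_apply, Matrix.of_apply]
  rw [add_comm (S.E φ β y), sub_right_comm]

theorem rho_pos (S : FullSymbol M) (φ : Coord M) {y : R4} (hy : y ∈ φ.1.target) :
    0 < S.rho φ y :=
  Real.rpow_pos_of_pos (neg_pos.2 (S.det_gDens_neg φ hy)) _

/-- The coefficient at `p_a p_b` of the bracket `{S_prin, adj S_prin, S_prin}`, which is a quadratic
form in `p`. It is not symmetrized: `a` belongs to the differentiated factor, `b` to the adjugate. -/
noncomputable def bracketCoeff (S : FullSymbol M) (φ : Coord M) (y : R4) (a b : Fin 4) : Mat2 :=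
  ∑ γ, (pderiv γ (S.E φ a) y * (S.E φ b y).adjugate * S.E φ γ y
    - S.E φ γ y * (S.E φ b y).adjugate * pderiv γ (S.E φ a) y)

theorem bracket_prin (S : FullSymbol M) (φ : Coord M) {y : R4} (hy : y ∈ φ.1.target) (p : R4) :
    bracket (S.prin φ) (fun z p => (S.prin φ z p).adjugate) (S.prin φ) y p
      = ∑ a, ∑ b, (p a * p b) • S.bracketCoeff φ y a b := by
  have hx : ∀ γ, pderiv γ (fun z => S.prin φ z p) y = ∑ a, p a • pderiv γ (S.E φ a) y :=
    fun γ => pderiv_sum_smul γ (fun a => p a) fun a => S.differentiableAt_E φ hy a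
  have hadj : (S.prin φ y p).adjugate = ∑ b, p b • (S.E φ b y).adjugate :=
    adjugate_sum_smul (fun a => p a) fun a => S.E φ a y
  simp only [bracket, hx, hadj, S.pderiv_prin φ y, bracketCoeff, Finset.smul_sum, smul_sub]
  simp only [Finset.sum_sub_distrib]
  congr 1
  · simp only [Finset.sum_mul, Finset.mul_sum, Matrix.smul_mul, Matrix.mul_smul, smul_smul]
    rw [Finset.sum_comm]
    refine (Finset.sum_congr rfl fun b _ => Finset.sum_comm).trans ?_
    rw [Finset.sum_comm]
    refine Finset.sum_congr rfl fun a _ => Finset.sum_congr rfl fun b _ =>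
      Finset.sum_congr rfl fun γ _ => ?_
    rw [mul_comm]
  · simp only [Finset.sum_mul, Finset.mul_sum, Matrix.smul_mul, Matrix.mul_smul, smul_smul]
    rw [Finset.sum_comm]
    refine Finset.sum_congr rfl fun a _ => ?_
    rw [Finset.sum_comm]

/-- The covariant subprincipal symbol with the derivatives in `p` carried out. The factor `1/16`
becomes `1/8` because both orders of differentiation contribute equally. -/
theorem csub_eq (S : FullSymbol M) (φ : Coord M) {y : R4} (hy : y ∈ φ.1.target) :
    S.csub φ y = S.sub φ y + (Complex.I / 8) • ∑ α, ∑ β,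
      (S.gDens φ y)⁻¹ α β • S.bracketCoeff φ y α β := by
  have hsymm : ∀ α β, (S.gDens φ y)⁻¹ α β = (S.gDens φ y)⁻¹ β α := fun α β => by
    conv_lhs => rw [← S.gDens_symm, ← Matrix.transpose_nonsing_inv]
    rfl
  have hB : bracket (S.prin φ) (fun z p => (S.prin φ z p).adjugate) (S.prin φ) y
      = fun p => ∑ a, ∑ b, (p a * p b) • S.bracketCoeff φ y a b :=
    funext fun p => S.bracket_prin φ hy p
  have hswap : ∑ α, ∑ β, (S.gDens φ y)⁻¹ α β • S.bracketCoeff φ y β α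
      = ∑ α, ∑ β, (S.gDens φ y)⁻¹ α β • S.bracketCoeff φ y α β := by
    rw [Finset.sum_comm]
    exact Finset.sum_congr rfl fun α _ => Finset.sum_congr rfl fun β _ => by rw [hsymm]
  simp only [csub, hB, pderiv_quadratic, pderiv_linear]
  simp only [smul_add, Finset.sum_add_distrib, hswap]
  rw [← add_smul]
  congr 2
  ring

/-- In terms of the coefficients of `E^α` in the basis `pauli`, the inverse metric density is the
Minkowski matrix. -/
theorem sum_inv_gDens_mul_coeff (S : FullSymbol M) (φ : Coord M) {y : R4} (hy : y ∈ φ.1.target) :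
    (Matrix.of fun α j => coeff (S.E φ α y) j)ᵀ * (S.gDens φ y)⁻¹
      * (Matrix.of fun α j => coeff (S.E φ α y) j)
      = Matrix.diagonal (![1, 1, 1, -1] : Fin 4 → ℝ) := by
  let C : Matrix (Fin 4) (Fin 4) ℝ := Matrix.of fun α j => coeff (S.E φ α y) j
  let η : Matrix (Fin 4) (Fin 4) ℝ := Matrix.diagonal ![1, 1, 1, -1]
  change Cᵀ * (S.gDens φ y)⁻¹ * C = η
  have hE : ∀ α, S.E φ α y = ∑ j, C α j • pauli j := fun α =>
    eq_sum_coeff (S.hermitian_E φ α y hy)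
  have hg : S.gDens φ y = C * η * Cᵀ := by
    ext α β
    simp only [η, gDens, hE, Matrix.of_apply, Matrix.mul_apply, Matrix.transpose_apply]
    generalize C = D
    simp [Fin.sum_univ_four, pauli, Matrix.det_fin_two]
    ring
  have hη : η * η = 1 := by
    ext i j
    fin_cases i <;> fin_cases j <;> simp [η]
  have hC : IsUnit C.det := by
    refine isUnit_iff_ne_zero.2 fun h0 => (S.det_gDens_neg φ hy).ne ?_
    rw [hg, Matrix.det_mul, Matrix.det_mul, h0, zero_mul, zero_mul]
  have hC' : IsUnit (Cᵀ).det := by rwa [Matrix.det_transpose]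
  rw [hg, Matrix.mul_inv_rev, Matrix.mul_inv_rev, Matrix.inv_eq_right_inv hη,
    Matrix.mul_nonsing_inv_cancel_left _ _ hC', mul_assoc, Matrix.nonsing_inv_mul _ hC, mul_one]

/-- Contraction of a bilinear expression with the inverse metric density, computed in the basis
`pauli`. -/
theorem sum_inv_gDens_bilin (S : FullSymbol M) (φ : Coord M) {y : R4} (hy : y ∈ φ.1.target)
    (B : Mat2 →ₗ[ℝ] Mat2 →ₗ[ℝ] Mat2) :
    ∑ α, ∑ β, (S.gDens φ y)⁻¹ α β • B (S.E φ α y) (S.E φ β y)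
      = ∑ j, (![1, 1, 1, -1] : Fin 4 → ℝ) j • B (pauli j) (pauli j) := by
  have hη := S.sum_inv_gDens_mul_coeff φ hy
  have hE : ∀ α, S.E φ α y = ∑ j, coeff (S.E φ α y) j • pauli j := fun α =>
    eq_sum_coeff (S.hermitian_E φ α y hy)
  calc ∑ α, ∑ β, (S.gDens φ y)⁻¹ α β • B (S.E φ α y) (S.E φ β y)
      = ∑ α, ∑ β, ∑ k, ∑ j, (coeff (S.E φ α y) j * (S.gDens φ y)⁻¹ α β
          * coeff (S.E φ β y) k) • B (pauli j) (pauli k) := by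
        refine Finset.sum_congr rfl fun α _ => Finset.sum_congr rfl fun β _ => ?_
        conv_lhs => rw [hE α, hE β]
        simp only [map_sum, map_smul, LinearMap.sum_apply, LinearMap.smul_apply, Finset.smul_sum,
          smul_smul]
        refine Finset.sum_congr rfl fun k _ => Finset.sum_congr rfl fun j _ => ?_
        congr 1
        ring
    _ = ∑ j, ∑ k, ((Matrix.of fun α j => coeff (S.E φ α y) j)ᵀ * (S.gDens φ y)⁻¹
          * (Matrix.of fun α j => coeff (S.E φ α y) j)) j k • B (pauli j) (pauli k) := by
        simp only [Matrix.mul_apply, Matrix.transpose_apply, Matrix.of_apply, Finset.sum_mul,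
          Finset.sum_smul]
        simp only [Fin.sum_univ_four]
        abel
    _ = _ := by
        rw [hη]
        simp [Matrix.diagonal_apply, ite_smul]

/-- The Fierz identity `g_{αβ} E^α X adj E^β = -2 (tr X) I`. -/
theorem sum_E_mul_adjugate (S : FullSymbol M) (φ : Coord M) {y : R4} (hy : y ∈ φ.1.target)
    (X : Mat2) :
    ∑ α, ∑ β, (S.gDens φ y)⁻¹ α β • (S.E φ α y * X * (S.E φ β y).adjugate)
      = (-2 * X.trace) • (1 : Mat2) := by
  let B : Mat2 →ₗ[ℝ] Mat2 →ₗ[ℝ] Mat2 := LinearMap.mk₂ ℝ (fun A A' => A * X * A'.adjugate)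
    (by intros; simp [add_mul]) (by intros; simp)
    (by intros; simp [adjugate_add, mul_add])
    (by intros; simp [adjugate_real_smul])
  exact (S.sum_inv_gDens_bilin φ hy B).trans (sum_pauli_mul_adjugate X)

/-- The Fierz identity with the two factors in the opposite order. -/
theorem sum_adjugate_E_mul (S : FullSymbol M) (φ : Coord M) {y : R4} (hy : y ∈ φ.1.target)
    (X : Mat2) :
    ∑ α, ∑ β, (S.gDens φ y)⁻¹ α β • ((S.E φ β y).adjugate * X * S.E φ α y)
      = (-2 * X.trace) • (1 : Mat2) := by
  let B : Mat2 →ₗ[ℝ] Mat2 →ₗ[ℝ] Mat2 := LinearMap.mk₂ ℝ (fun A A' => A'.adjugate * X * A)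
    (by intros; simp [mul_add]) (by intros; simp)
    (by intros; simp [adjugate_add, add_mul])
    (by intros; simp [adjugate_real_smul])
  exact (S.sum_inv_gDens_bilin φ hy B).trans (sum_adjugate_pauli_mul X)

/-! ### Gauge transformation of the encoded objects -/

/-- `R` carries the principal symbol of `S` to that of `S'`: `S'_prin = R* S_prin R`. -/
def PrinGauge (R : M → Matrix.SpecialLinearGroup (Fin 2) ℂ) (S S' : FullSymbol M) : Prop :=
  ∀ φ : Coord M, ∀ y ∈ φ.1.target, ∀ p : R4,
    S'.prin φ y p = (inCoord φ R y)ᴴ * S.prin φ y p * inCoord φ R y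

/-- The inhomogeneous term `R*_{x^γ} E^γ R - R* E^γ R_{x^γ}` of the gauge transformation. -/
noncomputable def gaugeTerm (R : M → Matrix.SpecialLinearGroup (Fin 2) ℂ) (S : FullSymbol M)
    (φ : Coord M) (y : R4) : Mat2 :=
  ∑ γ, (pderiv γ (fun z => (inCoord φ R z)ᴴ) y * S.E φ γ y * inCoord φ R y
    - (inCoord φ R y)ᴴ * S.E φ γ y * pderiv γ (inCoord φ R) y)

section PrinGauge

variable {R : M → Matrix.SpecialLinearGroup (Fin 2) ℂ} {S S' : FullSymbol M}

theorem PrinGauge.refl (S : FullSymbol M) : PrinGauge (fun _ => 1) S S := by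
  intro φ y _ p
  simp [inCoord]

theorem PrinGauge.trans {T : M → Matrix.SpecialLinearGroup (Fin 2) ℂ} {S'' : FullSymbol M}
    (h : PrinGauge R S S') (h' : PrinGauge T S' S'') : PrinGauge (fun x => R x * T x) S S'' := by
  intro φ y hy p
  rw [h' φ y hy, h φ y hy]
  simp [inCoord, Matrix.conjTranspose_mul, mul_assoc]

theorem PrinGauge.symm (h : PrinGauge R S S') : PrinGauge (fun x => (R x)⁻¹) S' S := by
  intro φ y hy p
  rw [conjTranspose_mul_mul_cancel (det_inCoord φ R y) (h φ y hy p).symm]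
  simp [inCoord, Matrix.SpecialLinearGroup.coe_inv]

theorem PrinGauge.E_eq (h : PrinGauge R S S') (φ : Coord M) {y : R4} (hy : y ∈ φ.1.target)
    (α : Fin 4) : S'.E φ α y = (inCoord φ R y)ᴴ * S.E φ α y * inCoord φ R y := by
  simpa only [prin_single] using h φ y hy (EuclideanSpace.single α 1)

theorem PrinGauge.gDens_eq (h : PrinGauge R S S') (φ : Coord M) {y : R4} (hy : y ∈ φ.1.target) :
    S'.gDens φ y = S.gDens φ y := by
  ext α β
  simp only [gDens, Matrix.of_apply, h.E_eq φ hy, ← mul_add, ← add_mul,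
    det_conjTranspose_mul_mul (det_inCoord φ R y)]

theorem PrinGauge.rho_eq (h : PrinGauge R S S') (φ : Coord M) {y : R4} (hy : y ∈ φ.1.target) :
    S'.rho φ y = S.rho φ y := by
  rw [rho, rho, h.gDens_eq φ hy]

theorem PrinGauge.metric_eq (h : PrinGauge R S S') (φ : Coord M) {y : R4}
    (hy : y ∈ φ.1.target) : S'.metric φ y = S.metric φ y := by
  rw [metric, metric, h.gDens_eq φ hy, h.rho_eq φ hy]

/-- The framings differ by the Lorentz transformation of `R`. -/
theorem PrinGauge.frame_eq (h : PrinGauge R S S') (φ : Coord M) {y : R4}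
    (hy : y ∈ φ.1.target) : S'.frame φ y = lorentz (inCoord φ R y) * S.frame φ y := by
  ext j α
  have hE : S'.E φ α y = ∑ k, coeff (S.E φ α y) k •
      ((inCoord φ R y)ᴴ * pauli k * inCoord φ R y) := by
    rw [h.E_eq φ hy]
    conv_lhs => rw [eq_sum_coeff (S.hermitian_E φ α y hy)]
    simp only [Finset.mul_sum, Finset.sum_mul, Matrix.mul_smul, Matrix.smul_mul]
  simp only [frame, Matrix.mul_apply, Matrix.of_apply, h.rho_eq φ hy, lorentz]
  rw [hE, sum_coeff_smul, Finset.mul_sum]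
  exact Finset.sum_congr rfl fun k _ => by ring

theorem PrinGauge.topCharge_eq (h : PrinGauge R S S') (φ : Coord M) {y : R4}
    (hy : y ∈ φ.1.target) : S'.topCharge φ y = S.topCharge φ y := by
  rw [topCharge, topCharge, h.frame_eq φ hy, Matrix.det_mul, det_lorentz (det_inCoord φ R y),
    one_mul]

theorem PrinGauge.temCharge_eq (h : PrinGauge R S S') {q : CovectorField M}
    (hq : S.IsTimelike q) (φ : Coord M) {y : R4} (hy : y ∈ φ.1.target) :
    S'.temCharge q φ y = S.temCharge q φ y := by
  have hdet : 0 < (S.prin φ y (WithLp.toLp 2 fun α => q.comp φ α y)).det.re := by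
    have hm := hq φ y hy
    simp only [metric, Matrix.smul_apply, smul_eq_mul, mul_assoc, ← Finset.mul_sum] at hm
    have hρ : 0 < (S.rho φ y ^ 2)⁻¹ := inv_pos.2 (pow_pos (S.rho_pos φ hy) 2)
    rw [S.det_prin φ hy, Complex.ofReal_re, neg_pos]
    simpa only [mul_assoc] using (pos_iff_neg_of_mul_neg hm).1 hρ
  have hρ : SignType.sign (S.rho φ y)⁻¹ = 1 := sign_pos (inv_pos.2 (S.rho_pos φ hy))
  rw [temCharge, temCharge, h φ y hy, h.rho_eq φ hy, sign_mul, sign_mul, hρ, one_mul, one_mul,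
    sign_trace_conjTranspose_mul_mul (S.prin_isHermitian φ hy _) hdet (det_inCoord φ R y)]

theorem PrinGauge.pderiv_E [IsManifold (𝓡 4) ∞ M] (h : PrinGauge R S S') (hR : SmoothSL M R)
    (φ : Coord M) {y : R4} (hy : y ∈ φ.1.target) (α γ : Fin 4) :
    pderiv γ (S'.E φ α) y
      = pderiv γ (fun z => (inCoord φ R z)ᴴ) y * S.E φ α y * inCoord φ R y
        + (inCoord φ R y)ᴴ * pderiv γ (S.E φ α) y * inCoord φ R y
        + (inCoord φ R y)ᴴ * S.E φ α y * pderiv γ (inCoord φ R) y := by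
  have hd := hR.differentiableAt_inCoord φ hy
  have hd' : ∀ i j, DifferentiableAt ℝ (fun z => (inCoord φ R z)ᴴ i j) y :=
    fun i j => (hd j i).star
  have hE : pderiv γ (S'.E φ α) y
      = pderiv γ (fun z => (inCoord φ R z)ᴴ * S.E φ α z * inCoord φ R z) y := by
    refine pderiv_congr γ ?_
    filter_upwards [φ.1.open_target.mem_nhds hy] with z hz
    exact h.E_eq φ hz α
  rw [hE, pderiv_mul γ (differentiableAt_mul_apply hd' (S.differentiableAt_E φ hy α)) hd,
    pderiv_mul γ hd' (S.differentiableAt_E φ hy α), add_mul]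

/-- The bracket picks up `-4` times the inhomogeneous term. Of the terms with derivatives of `R`,
those containing `R_{x^γ} R⁻¹` between `E^α` and `adj E^β` drop out by the Fierz identity, because
`R_{x^γ} R⁻¹` is trace-free; in the others `g_{αβ} E^α adj E^β = -4 I`. -/
theorem PrinGauge.sum_bracketCoeff [IsManifold (𝓡 4) ∞ M] (h : PrinGauge R S S')
    (hR : SmoothSL M R) (φ : Coord M) {y : R4} (hy : y ∈ φ.1.target) :
    ∑ α, ∑ β, (S'.gDens φ y)⁻¹ α β • S'.bracketCoeff φ y α β
      = (inCoord φ R y)ᴴ * (∑ α, ∑ β, (S.gDens φ y)⁻¹ α β • S.bracketCoeff φ y α β)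
          * inCoord φ R y - (4 : ℂ) • gaugeTerm R S φ y := by
  have hdet := det_inCoord φ R y
  have hpd := h.pderiv_E hR φ hy
  have hE := h.E_eq φ hy
  have htr : ∀ γ, (pderiv γ (inCoord φ R) y * (inCoord φ R y).adjugate).trace = 0 := fun γ =>
    trace_pderiv_mul_adjugate γ (hR.differentiableAt_inCoord φ hy) (det_inCoord φ R)
  have hstar : ∀ γ, pderiv γ (fun z => (inCoord φ R z)ᴴ) y = (pderiv γ (inCoord φ R) y)ᴴ :=
    fun γ => pderiv_conjTranspose γ _ y
  simp only [gaugeTerm, hstar] at hpd ⊢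
  rw [h.gDens_eq φ hy]
  generalize inCoord φ R y = r at *
  have hr : r * r.adjugate = 1 := mul_adjugate_of_det_eq_one hdet
  have hr' : rᴴ.adjugate * rᴴ = 1 := by
    rw [Matrix.adjugate_mul, Matrix.det_conjTranspose, hdet, star_one, one_smul]
  -- The outer factors of `adj E'^β = R⁻¹ adj E^β (R*)⁻¹` cancel wherever they meet `R` and `R*`.
  have hterm : ∀ a b, S'.bracketCoeff φ y a b = ∑ γ,
      ((pderiv γ (inCoord φ R) y)ᴴ * (S.E φ a y * 1 * (S.E φ b y).adjugate) * (S.E φ γ y * r)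
        + rᴴ * (pderiv γ (S.E φ a) y * (S.E φ b y).adjugate * S.E φ γ y
            - S.E φ γ y * (S.E φ b y).adjugate * pderiv γ (S.E φ a) y) * r
        + rᴴ * (S.E φ a y * (pderiv γ (inCoord φ R) y * r.adjugate) * (S.E φ b y).adjugate)
            * (S.E φ γ y * r)
        - (rᴴ * S.E φ γ y) * ((S.E φ b y).adjugate * (rᴴ.adjugate * (pderiv γ (inCoord φ R) y)ᴴ)
            * S.E φ a y) * r
        - (rᴴ * S.E φ γ y) * ((S.E φ b y).adjugate * 1 * S.E φ a y)
            * pderiv γ (inCoord φ R) y) := by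
    intro a b
    refine Finset.sum_congr rfl fun γ _ => ?_
    have hr2 : ∀ P : Mat2, r * (r.adjugate * P) = P := fun P => by rw [← mul_assoc, hr, one_mul]
    have hr3 : ∀ P : Mat2, rᴴ.adjugate * (rᴴ * P) = P := fun P => by
      rw [← mul_assoc, hr', one_mul]
    simp only [hpd, hE, adjugate_conjTranspose_mul_mul]
    simp only [mul_add, add_mul, mul_sub, sub_mul,
      mul_assoc, hr2, hr3, one_mul]
    abel
  have hsum : ∀ (f : Fin 4 → Fin 4 → Mat2) (L K : Mat2),
      ∑ α, ∑ β, (S.gDens φ y)⁻¹ α β • (L * f α β * K)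
        = L * (∑ α, ∑ β, (S.gDens φ y)⁻¹ α β • f α β) * K := by
    intro f L K
    simp only [Finset.mul_sum, Finset.sum_mul, Matrix.mul_smul, Matrix.smul_mul]
  have htr' : ∀ γ, (rᴴ.adjugate * (pderiv γ (inCoord φ R) y)ᴴ).trace = 0 := fun γ => by
    rw [← Matrix.adjugate_conjTranspose, ← Matrix.conjTranspose_mul, Matrix.trace_conjTranspose,
      htr, star_zero]
  have hcomm : ∀ f : Fin 4 → Fin 4 → Fin 4 → Mat2,
      ∑ α, ∑ β, (S.gDens φ y)⁻¹ α β • ∑ γ, f γ α β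
        = ∑ γ, ∑ α, ∑ β, (S.gDens φ y)⁻¹ α β • f γ α β := by
    intro f
    simp only [Finset.smul_sum]
    exact (Finset.sum_congr rfl fun α _ => Finset.sum_comm).trans Finset.sum_comm
  simp only [hterm]
  simp only [bracketCoeff, hcomm, smul_add, smul_sub, Finset.sum_add_distrib,
    Finset.sum_sub_distrib, hsum, S.sum_E_mul_adjugate φ hy, S.sum_adjugate_E_mul φ hy, htr, htr']
  simp only [Matrix.trace_one, Fintype.card_fin, Nat.cast_ofNat, mul_zero, zero_smul, zero_mul,
    Finset.sum_const_zero, Matrix.mul_smul, Matrix.smul_mul, mul_one, ← Finset.smul_sum, mul_sub,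
    sub_mul, Finset.mul_sum, Finset.sum_mul, mul_assoc, add_zero, sub_zero,
    Finset.sum_sub_distrib]
  module

/-- The covariant subprincipal symbol changes by `A ↦ R* A R` up to the failure of the gauge
transformation law for the subprincipal symbols. -/
theorem PrinGauge.csub_eq [IsManifold (𝓡 4) ∞ M] (h : PrinGauge R S S') (hR : SmoothSL M R)
    (φ : Coord M) {y : R4} (hy : y ∈ φ.1.target) :
    S'.csub φ y = (inCoord φ R y)ᴴ * S.csub φ y * inCoord φ R y
      + (S'.sub φ y - ((inCoord φ R y)ᴴ * S.sub φ y * inCoord φ R y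
        + (Complex.I / 2) • gaugeTerm R S φ y)) := by
  rw [S'.csub_eq φ hy, S.csub_eq φ hy, h.sum_bracketCoeff hR φ hy, smul_sub, smul_smul,
    show Complex.I / 8 * 4 = Complex.I / 2 by ring]
  simp only [mul_add, add_mul, Matrix.mul_smul, Matrix.smul_mul]
  abel

end PrinGauge

/-- A gauge transformation acts on the principal symbol and on the covariant subprincipal symbol
by `A ↦ R* A R`, and it is determined by these two actions. -/
theorem slEquiv_iff [IsManifold (𝓡 4) ∞ M] (S S' : FullSymbol M) :
    S.SLEquiv S' ↔ ∃ R : M → Matrix.SpecialLinearGroup (Fin 2) ℂ, SmoothSL M R ∧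
      PrinGauge R S S' ∧ ∀ φ : Coord M, ∀ y ∈ φ.1.target,
        S'.csub φ y = (inCoord φ R y)ᴴ * S.csub φ y * inCoord φ R y := by
  refine exists_congr fun R => and_congr_right fun hR => ?_
  simp only [pderiv_full]
  change (∀ φ : Coord M, ∀ y ∈ φ.1.target, ∀ p : R4, S'.prin φ y p + S'.sub φ y
    = (inCoord φ R y)ᴴ * (S.prin φ y p + S.sub φ y) * inCoord φ R y
      + (Complex.I / 2) • gaugeTerm R S φ y) ↔ _
  constructor
  · intro h
    -- The part of the equation that does not depend on the momentum, isolated at `p = 0`.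
    have hsub : ∀ φ : Coord M, ∀ y ∈ φ.1.target, S'.sub φ y
        = (inCoord φ R y)ᴴ * S.sub φ y * inCoord φ R y
          + (Complex.I / 2) • gaugeTerm R S φ y := by
      intro φ y hy
      simpa [prin] using h φ y hy 0
    have hP : PrinGauge R S S' := by
      intro φ y hy p
      have hp := h φ y hy p
      rw [hsub φ y hy, mul_add, add_mul, add_assoc] at hp
      exact add_right_cancel hp
    refine ⟨hP, fun φ y hy => ?_⟩
    rw [hP.csub_eq hR φ hy, hsub φ y hy, sub_self, add_zero]
  · rintro ⟨hP, hc⟩ φ y hy p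
    have hsub := hP.csub_eq hR φ hy
    rw [hc φ y hy, left_eq_add, sub_eq_zero] at hsub
    rw [hP φ y hy, hsub, mul_add, add_mul, add_assoc]

theorem csub_eq_prin_potential (S : FullSymbol M) (φ : Coord M) (y : φ.1.target) :
    S.csub φ y = S.prin φ y (S.potential φ y) :=
  (S.existsUnique_prin_eq φ y.2 (S.csub_isHermitian φ y.2)).choose_spec.1

theorem eq_potential {S : FullSymbol M} {φ : Coord M} (y : φ.1.target) {p : R4}
    (h : S.csub φ y = S.prin φ y p) : p = S.potential φ y :=
  (S.existsUnique_prin_eq φ y.2 (S.csub_isHermitian φ y.2)).choose_spec.2 p h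

theorem PrinGauge.potential_eq_iff {R : M → Matrix.SpecialLinearGroup (Fin 2) ℂ}
    {S S' : FullSymbol M} (h : PrinGauge R S S') (φ : Coord M) (y : φ.1.target) :
    S.potential φ y = S'.potential φ y ↔
      S'.csub φ y = (inCoord φ R y)ᴴ * S.csub φ y * inCoord φ R y := by
  rw [S.csub_eq_prin_potential φ y, ← h φ y y.2]
  exact ⟨fun hp => hp ▸ S'.csub_eq_prin_potential φ y, fun hc => eq_potential y hc⟩

theorem spinStructure_eq_iff (S S' : FullSymbol M) :
    S.spinStructure = S'.spinStructure ↔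
      ∃ R : M → Matrix.SpecialLinearGroup (Fin 2) ℂ, SmoothSL M R ∧ PrinGauge R S S' := by
  constructor
  · intro h
    have : S' ∈ S'.spinStructure := ⟨fun _ => 1, SmoothSL.one, PrinGauge.refl S'⟩
    rwa [← h] at this
  · rintro ⟨R, hR, h⟩
    ext T
    exact ⟨fun ⟨Q, hQ, hT⟩ => ⟨_, hR.inv.mul hQ, h.symm.trans hT⟩,
      fun ⟨Q, hQ, hT⟩ => ⟨_, hR.mul hQ, h.trans hT⟩⟩

end FullSymbol

end Manifold

end SesqForm

theorem theorem4p2 {M : Type*} [TopologicalSpace M] [ChartedSpace SesqForm.R4 M]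
    [IsManifold (𝓡 4) ∞ M] [T2Space M] [SecondCountableTopology M] [ConnectedSpace M]
    (o : SesqForm.Orientation M) (S S' : SesqForm.FullSymbol M)
    (q : SesqForm.CovectorField M) (hq : S.IsTimelike q) :
    S.SLEquiv S' ↔
      (∀ φ : SesqForm.Coord M, ∀ y ∈ φ.1.target, S.metric φ y = S'.metric φ y) ∧
      (∀ φ : SesqForm.Coord M, ∀ y : φ.1.target, S.potential φ y = S'.potential φ y) ∧
      (∀ φ ∈ o.charts, ∀ y ∈ φ.1.target, S.topCharge φ y = S'.topCharge φ y) ∧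
      (∀ φ : SesqForm.Coord M, ∀ y ∈ φ.1.target, S.temCharge q φ y = S'.temCharge q φ y) ∧
      S.spinStructure = S'.spinStructure := by
  rw [SesqForm.FullSymbol.slEquiv_iff, SesqForm.FullSymbol.spinStructure_eq_iff]
  constructor
  · rintro ⟨R, hR, h, hc⟩
    exact ⟨fun φ y hy => (h.metric_eq φ hy).symm,
      fun φ y => (h.potential_eq_iff φ y).2 (hc φ y y.2),
      fun φ _ y hy => (h.topCharge_eq φ hy).symm,
      fun φ y hy => (h.temCharge_eq hq φ hy).symm, R, hR, h⟩
  · rintro ⟨-, hA, -, -, R, hR, h⟩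
    exact ⟨R, hR, h, fun φ y hy => (h.potential_eq_iff φ ⟨y, hy⟩).1 (hA φ ⟨y, hy⟩)⟩
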